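/- Let $\mathbb{K}$ be a field of characteristic zero and let $A$ be a free associative unital $\mathbb{K}$-algebra (on any set of generators). Let $(\Omega^{\bullet}(A),\mathrm{d})$ be the universal differential envelope of $A$, i.e. the universal differential graded $\mathbb{K}$-algebra (graded over $\mathbb{N}$) equipped with an algebra map from $A$ to its degree-zero part; its degree-$n$ part is spanned by the products $a_0\,\mathrm{d}a_1\cdots \mathrm{d}a_n$ with $a_i\in A$. Let $\mathrm{DR}^{\bullet}(A)$ be the Karoubi–de Rham complex, i.e. the quotient of the graded vector space $\Omega^{\bullet}(A)$ by the linear span of the graded commutators $xy-(-1)^{ij}yx$ ($x\in\Omega^i(A)$, $y\in\Omega^j(A)$), with the induced differential $\mathrm{d}$. Let $[A,A]\subseteq A$ be the linear span of the commutators $[u,v]=uv-vu$, and let $b\colon \mathrm{DR}^1(A)\to[A,A]$ be the (well-defined) linear map with $b(u\,\mathrm{d}v)=[u,v]$ for all $u,v\in A$. Let $\mathrm{DR}^2(A)_{\mathrm{cl}}=\{\omega\in \mathrm{DR}^2(A) : \mathrm{d}\omega=0\}$ be the subspace of closed $2$-forms. Then every $\omega\in \mathrm{DR}^2(A)_{\mathrm{cl}}$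 has a primitive, i.e. there is $\alpha\in \mathrm{DR}^1(A)$ with $\mathrm{d}\alpha=\omega$, and there is a unique linear isomorphism $$e\colon \mathrm{DR}^2(A)_{\mathrm{cl}}\longrightarrow [A,A]$$ such that $e(\omega)=b(\alpha)$ for every $\omega\in \mathrm{DR}^2(A)_{\mathrm{cl}}$ and every primitive $\alpha\in \mathrm{DR}^1(A)$ of $\omega$. -/

import Mathlib

namespace KaroubiDeRham

open TensorProduct DirectSum

section Envelope

variable (K : Type*) [Field K] (A : Type*) [Ring A] [Algebra K A]

/-- Defining relations of the universal differential envelope: it is generated by symbols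
`a = (a, 0)` and `da = (0, a)`, both `K`-linear in `a ∈ A`; the first symbols multiply as in `A`
(with the same unit), and `d(ab) = (da) b + a (db)`. -/
inductive Rel : TensorAlgebra K (A × A) → TensorAlgebra K (A × A) → Prop
  | one : Rel (TensorAlgebra.ι K (1, 0)) 1
  | mul (a b : A) : Rel (TensorAlgebra.ι K (a * b, 0))
      (TensorAlgebra.ι K (a, 0) * TensorAlgebra.ι K (b, 0))
  | leibniz (a b : A) : Rel (TensorAlgebra.ι K (0, a * b))
      (TensorAlgebra.ι K (0, a) * TensorAlgebra.ι K (b, 0) +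
        TensorAlgebra.ι K (a, 0) * TensorAlgebra.ι K (0, b))

/-- The algebra `Ω•(A)` of noncommutative differential forms: the universal differential envelope
of `A`. Its universal property among dg-algebras is `existsUnique_lift` below. -/
def Omega := RingQuot (Rel K A)

noncomputable instance : Ring (Omega K A) := inferInstanceAs (Ring (RingQuot (Rel K A)))

noncomputable instance : Algebra K (Omega K A) :=
  inferInstanceAs (Algebra K (RingQuot (Rel K A)))

/-- The quotient map from the tensor algebra on the generators. -/
noncomputable def mk : TensorAlgebra K (A × A) →ₐ[K] Omega K A :=
  RingQuot.mkAlgHom K (Rel K A)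

theorem mk_one : mk K A (TensorAlgebra.ι K (1, 0)) = 1 :=
  (RingQuot.mkAlgHom_rel K Rel.one).trans (map_one _)

theorem mk_mul (a b : A) : mk K A (TensorAlgebra.ι K (a * b, 0)) =
    mk K A (TensorAlgebra.ι K (a, 0)) * mk K A (TensorAlgebra.ι K (b, 0)) :=
  (RingQuot.mkAlgHom_rel K (Rel.mul a b)).trans (map_mul _ _ _)

theorem mk_leibniz (a b : A) : mk K A (TensorAlgebra.ι K (0, a * b)) =
    mk K A (TensorAlgebra.ι K (0, a)) * mk K A (TensorAlgebra.ι K (b, 0)) +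
      mk K A (TensorAlgebra.ι K (a, 0)) * mk K A (TensorAlgebra.ι K (0, b)) :=
  (RingQuot.mkAlgHom_rel K (Rel.leibniz a b)).trans
    ((map_add _ _ _).trans (congrArg₂ (· + ·) (map_mul _ _ _) (map_mul _ _ _)))

/-- The inclusion of `A` as the forms of degree zero. -/
noncomputable def incl : A →ₐ[K] Omega K A :=
  AlgHom.ofLinearMap ((mk K A).toLinearMap ∘ₗ TensorAlgebra.ι K ∘ₗ LinearMap.inl K A A)
    (mk_one K A) (mk_mul K A)

/-- The linear map `a ↦ da`. -/
noncomputable def del : A →ₗ[K] Omega K A :=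
  (mk K A).toLinearMap ∘ₗ TensorAlgebra.ι K ∘ₗ LinearMap.inr K A A

theorem incl_apply (a : A) : incl K A a = mk K A (TensorAlgebra.ι K (a, 0)) := rfl

theorem del_apply (a : A) : del K A a = mk K A (TensorAlgebra.ι K (0, a)) := rfl

theorem del_mul (a b : A) :
    del K A (a * b) = del K A a * incl K A b + incl K A a * del K A b :=
  mk_leibniz K A a b

theorem del_one : del K A 1 = 0 := by
  have h := del_mul K A 1 1
  simpa using h

variable {K A} in
/-- Algebra maps out of `Ω•(A)`: an algebra map on `A` and a derivation along it. -/
noncomputable def lift {B : Type*} [Semiring B] [Algebra K B] (f : A →ₐ[K] B) (D : A →ₗ[K] B)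
    (hD : ∀ a b, D (a * b) = D a * f b + f a * D b) : Omega K A →ₐ[K] B :=
  RingQuot.liftAlgHom K ⟨TensorAlgebra.lift K (LinearMap.coprod f.toLinearMap D), by
    intro x y h
    induction h with
    | one => simp
    | mul a b => simp
    | leibniz a b => simp [hD]⟩

variable {K A} in
theorem lift_mk {B : Type*} [Semiring B] [Algebra K B] (f : A →ₐ[K] B) (D : A →ₗ[K] B)
    (hD : ∀ a b, D (a * b) = D a * f b + f a * D b) (t : TensorAlgebra K (A × A)) :
    lift f D hD (mk K A t) = TensorAlgebra.lift K (LinearMap.coprod f.toLinearMap D) t :=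
  RingQuot.liftAlgHom_mkAlgHom_apply K _ _ t

variable {K A} in
@[simp] theorem lift_incl {B : Type*} [Semiring B] [Algebra K B] (f : A →ₐ[K] B) (D : A →ₗ[K] B)
    (hD : ∀ a b, D (a * b) = D a * f b + f a * D b) (a : A) :
    lift f D hD (incl K A a) = f a := by
  rw [incl_apply, lift_mk]; simp

variable {K A} in
@[simp] theorem lift_del {B : Type*} [Semiring B] [Algebra K B] (f : A →ₐ[K] B) (D : A →ₗ[K] B)
    (hD : ∀ a b, D (a * b) = D a * f b + f a * D b) (a : A) :
    lift f D hD (del K A a) = D a := by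
  rw [del_apply, lift_mk]; simp

variable {K A} in
theorem omega_ext {B : Type*} [Semiring B] [Algebra K B] {u v : Omega K A →ₐ[K] B}
    (h0 : ∀ a, u (incl K A a) = v (incl K A a)) (h1 : ∀ a, u (del K A a) = v (del K A a)) :
    u = v := by
  refine RingQuot.ringQuot_ext' K _ _ (TensorAlgebra.hom_ext (LinearMap.ext fun x => ?_))
  have hx : x = (x.1, 0) + (0, x.2) := by simp
  have e : ∀ w : Omega K A →ₐ[K] B,
      w (mk K A (TensorAlgebra.ι K x)) = w (incl K A x.1) + w (del K A x.2) := fun w => by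
    rw [incl_apply, del_apply, ← map_add, ← map_add, ← map_add, ← hx]
  exact (e u).trans ((congrArg₂ (· + ·) (h0 x.1) (h1 x.2)).trans (e v).symm)

/-- Forms of degree `n`: the span of the products `a₀ da₁ ⋯ daₙ`, as the product of submodules
`A · (dA)ⁿ`. -/
noncomputable def deg (n : ℕ) : Submodule K (Omega K A) :=
  LinearMap.range (incl K A).toLinearMap * LinearMap.range (del K A) ^ n

theorem incl_mem (a : A) : incl K A a ∈ deg K A 0 := by
  rw [deg, Submodule.pow_zero, mul_one]
  exact ⟨a, rfl⟩

theorem one_mem_range : (1 : Omega K A) ∈ LinearMap.range (incl K A).toLinearMap :=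
  ⟨1, by simp⟩

theorem pow_le_deg (n : ℕ) : LinearMap.range (del K A) ^ n ≤ deg K A n := fun x hx => by
  rw [← one_mul x]
  exact Submodule.mul_mem_mul (one_mem_range K A) hx

theorem del_mem (a : A) : del K A a ∈ deg K A 1 :=
  pow_le_deg K A 1 (by rw [Submodule.pow_one]; exact ⟨a, rfl⟩)

theorem mem_deg_zero {x : Omega K A} (hx : x ∈ deg K A 0) : ∃ a, incl K A a = x := by
  rw [deg, Submodule.pow_zero, mul_one] at hx
  exact hx

theorem range_mul_range :
    LinearMap.range (incl K A).toLinearMap * LinearMap.range (incl K A).toLinearMap ≤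
      LinearMap.range (incl K A).toLinearMap := by
  rw [Submodule.mul_le]
  rintro _ ⟨a, rfl⟩ _ ⟨b, rfl⟩
  exact ⟨a * b, by simp⟩

theorem pow_mul_range (n : ℕ) :
    LinearMap.range (del K A) ^ n * LinearMap.range (incl K A).toLinearMap ≤ deg K A n := by
  have hswap : LinearMap.range (del K A) * LinearMap.range (incl K A).toLinearMap ≤
      LinearMap.range (incl K A).toLinearMap * LinearMap.range (del K A) := by
    rw [Submodule.mul_le]
    rintro _ ⟨a, rfl⟩ _ ⟨b, rfl⟩
    have h : del K A a * incl K A b =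
        incl K A 1 * del K A (a * b) - incl K A a * del K A b := by
      rw [del_mul, map_one, one_mul, add_sub_cancel_right]
    change del K A a * incl K A b ∈ _
    rw [h]
    exact Submodule.sub_mem _ (Submodule.mul_mem_mul ⟨_, rfl⟩ ⟨_, rfl⟩)
      (Submodule.mul_mem_mul ⟨_, rfl⟩ ⟨_, rfl⟩)
  induction n with
  | zero => rw [deg, Submodule.pow_zero, mul_one, one_mul]
  | succ n ih =>
    calc LinearMap.range (del K A) ^ (n + 1) * LinearMap.range (incl K A).toLinearMap
        = LinearMap.range (del K A) ^ n *
          (LinearMap.range (del K A) * LinearMap.range (incl K A).toLinearMap) := by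
          rw [pow_succ, mul_assoc]
      _ ≤ LinearMap.range (del K A) ^ n *
          (LinearMap.range (incl K A).toLinearMap * LinearMap.range (del K A)) :=
          mul_le_mul_right hswap _
      _ = LinearMap.range (del K A) ^ n * LinearMap.range (incl K A).toLinearMap *
          LinearMap.range (del K A) := by rw [mul_assoc]
      _ ≤ deg K A n * LinearMap.range (del K A) := mul_le_mul_left ih _
      _ = deg K A (n + 1) := by rw [deg, deg, mul_assoc, pow_succ]

instance : SetLike.GradedMonoid (deg K A) where
  one_mem := by simpa using incl_mem K A 1
  mul_mem i j x y hx hy := by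
    have h : deg K A i * deg K A j ≤ deg K A (i + j) :=
      calc deg K A i * deg K A j
          = LinearMap.range (incl K A).toLinearMap * (LinearMap.range (del K A) ^ i *
              LinearMap.range (incl K A).toLinearMap) * LinearMap.range (del K A) ^ j := by
            simp only [deg, mul_assoc]
        _ ≤ LinearMap.range (incl K A).toLinearMap * deg K A i * LinearMap.range (del K A) ^ j :=
            mul_le_mul_left (mul_le_mul_right (pow_mul_range K A i) _) _
        _ = (LinearMap.range (incl K A).toLinearMap * LinearMap.range (incl K A).toLinearMap) *
              LinearMap.range (del K A) ^ (i + j) := by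
            simp only [deg, mul_assoc, pow_add]
        _ ≤ deg K A (i + j) := mul_le_mul_left (range_mul_range K A) _
    exact h (Submodule.mul_mem_mul hx hy)

theorem incl_mul_mem (a : A) {n : ℕ} {x : Omega K A} (hx : x ∈ deg K A n) :
    incl K A a * x ∈ deg K A n := by
  have h := SetLike.mul_mem_graded (incl_mem K A a) hx
  rwa [zero_add] at h

theorem mul_incl_mem (a : A) {n : ℕ} {x : Omega K A} (hx : x ∈ deg K A n) :
    x * incl K A a ∈ deg K A n := by
  have h := SetLike.mul_mem_graded hx (incl_mem K A a)
  rwa [add_zero] at h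

/-- The inclusion of `A` in the external direct sum of the homogeneous components. -/
noncomputable def inclSum : A →ₗ[K] ⨁ n, deg K A n :=
  DirectSum.lof K ℕ (fun n => deg K A n) 0 ∘ₗ
    (incl K A).toLinearMap.codRestrict (deg K A 0) (incl_mem K A)

/-- The map `a ↦ da` to the external direct sum of the homogeneous components. -/
noncomputable def delSum : A →ₗ[K] ⨁ n, deg K A n :=
  DirectSum.lof K ℕ (fun n => deg K A n) 1 ∘ₗ
    (del K A).codRestrict (deg K A 1) (del_mem K A)

theorem inclSum_apply (a : A) :
    inclSum K A a = DirectSum.of (fun n => deg K A n) 0 ⟨incl K A a, incl_mem K A a⟩ := rfl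

theorem delSum_apply (a : A) :
    delSum K A a = DirectSum.of (fun n => deg K A n) 1 ⟨del K A a, del_mem K A a⟩ := rfl

theorem of_mul_of' {i j k : ℕ} (h : i + j = k) (x : deg K A i) (y : deg K A j) (z : deg K A k)
    (hz : (z : Omega K A) = x * y) :
    DirectSum.of (fun n => deg K A n) k z =
      DirectSum.of (fun n => deg K A n) i x * DirectSum.of (fun n => deg K A n) j y := by
  subst h
  rw [DirectSum.of_mul_of]
  exact congrArg _ (Subtype.ext hz)

theorem inclSum_one : inclSum K A 1 = 1 :=
  congrArg (DirectSum.of (fun n => deg K A n) 0) (Subtype.ext (map_one (incl K A)))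

theorem inclSum_mul (a b : A) : inclSum K A (a * b) = inclSum K A a * inclSum K A b :=
  of_mul_of' K A (add_zero 0) ⟨_, incl_mem K A a⟩ ⟨_, incl_mem K A b⟩ ⟨_, incl_mem K A _⟩
    (map_mul (incl K A) a b)

/-- `inclSum` as an algebra map. -/
noncomputable def inclSumHom : A →ₐ[K] ⨁ n, deg K A n :=
  AlgHom.ofLinearMap (inclSum K A) (inclSum_one K A) (inclSum_mul K A)

theorem delSum_mul (a b : A) : delSum K A (a * b) =
    delSum K A a * inclSumHom K A b + inclSumHom K A a * delSum K A b := by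
  have h1 : (⟨del K A (a * b), del_mem K A _⟩ : deg K A 1) =
      ⟨del K A a * incl K A b, mul_incl_mem K A b (del_mem K A a)⟩ +
      ⟨incl K A a * del K A b, incl_mul_mem K A a (del_mem K A b)⟩ :=
    Subtype.ext (del_mul K A a b)
  rw [delSum_apply, h1, map_add]
  exact congrArg₂ (· + ·) (of_mul_of' K A (add_zero 1) _ _ _ rfl)
    (of_mul_of' K A (zero_add 1) _ _ _ rfl)

/-- The map decomposing a form into its homogeneous components. -/
noncomputable def decomp : Omega K A →ₐ[K] ⨁ n, deg K A n :=
  lift (inclSumHom K A) (delSum K A) (delSum_mul K A)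

theorem decomp_incl (a : A) : decomp K A (incl K A a) =
    DirectSum.of (fun n => deg K A n) 0 ⟨incl K A a, incl_mem K A a⟩ :=
  lift_incl (inclSumHom K A) (delSum K A) (delSum_mul K A) a

theorem decomp_del (a : A) : decomp K A (del K A a) =
    DirectSum.of (fun n => deg K A n) 1 ⟨del K A a, del_mem K A a⟩ :=
  lift_del (inclSumHom K A) (delSum K A) (delSum_mul K A) a

theorem deg_succ (n : ℕ) : deg K A (n + 1) = deg K A n * LinearMap.range (del K A) := by
  rw [deg, deg, pow_succ, mul_assoc]

theorem decomp_of_mem {n : ℕ} {x : Omega K A} (hx : x ∈ deg K A n) :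
    decomp K A x = DirectSum.of (fun n => deg K A n) n ⟨x, hx⟩ := by
  induction n generalizing x with
  | zero =>
    obtain ⟨a, rfl⟩ := mem_deg_zero K A hx
    exact decomp_incl K A a
  | succ n ih =>
    have hx' := hx
    rw [deg_succ] at hx'
    induction hx' using Submodule.mul_induction_on' with
    | mem_mul_mem m hm y hy =>
      obtain ⟨a, rfl⟩ := hy
      rw [map_mul, ih hm, decomp_del]
      exact (of_mul_of' K A rfl _ _ _ rfl).symm
    | add x hx y hy hx' hy' =>
      rw [map_add, hx' (by rwa [deg_succ]), hy' (by rwa [deg_succ]), ← map_add]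
      rfl

/-- `Ω•(A)` is a graded algebra. -/
noncomputable instance : GradedAlgebra (deg K A) :=
  GradedAlgebra.ofAlgHom (deg K A) (decomp K A)
    (omega_ext (fun a => by simp [decomp_incl]) (fun a => by simp [decomp_del]))
    (fun n x => decomp_of_mem K A x.2)

/-- Auxiliary algebra map `x ↦ [[±x, dx], [0, x]]`, which packages the graded Leibniz rule. -/
noncomputable def dMat : Omega K A →ₐ[K] Matrix (Fin 2) (Fin 2) (Omega K A) :=
  lift
    (AlgHom.ofLinearMap
      { toFun := fun a => !![incl K A a, del K A a; 0, incl K A a]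
        map_add' := fun a b => by ext i j; fin_cases i <;> fin_cases j <;> simp
        map_smul' := fun c a => by ext i j; fin_cases i <;> fin_cases j <;> simp }
      (by ext i j; fin_cases i <;> fin_cases j <;> simp [del_one])
      (fun a b => by
        ext i j
        fin_cases i <;> fin_cases j <;> simp [del_mul, add_comm]))
    { toFun := fun a => !![-del K A a, 0; 0, del K A a]
      map_add' := fun a b => by ext i j; fin_cases i <;> fin_cases j <;> simp [add_comm]
      map_smul' := fun c a => by ext i j; fin_cases i <;> fin_cases j <;> simp }
    (fun a b => by
      ext i j
      fin_cases i <;> fin_cases j <;> simp [del_mul, add_comm])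

/-- The differential of `Ω•(A)`; by `d_incl`, `d_del` and `d_mul` it is the odd derivation with
`d(a) = da` and `d(da) = 0`. -/
noncomputable def d : Omega K A →ₗ[K] Omega K A :=
  Matrix.entryLinearMap K (Omega K A) 0 1 ∘ₗ (dMat K A).toLinearMap

@[simp] theorem d_incl (a : A) : d K A (incl K A a) = del K A a := by
  simp [d, dMat]

@[simp] theorem d_del (a : A) : d K A (del K A a) = 0 := by
  simp [d, dMat]

theorem omega_induction {P : Omega K A → Prop} (hadd : ∀ x y, P x → P y → P (x + y))
    (hmem : ∀ n, ∀ x ∈ deg K A n, P x) (x : Omega K A) : P x := by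
  classical
  rw [← DirectSum.sum_support_decompose (deg K A) x]
  refine Finset.sum_induction _ P hadd (hmem 0 0 (zero_mem _)) (fun n _ => ?_)
  exact hmem n _ (SetLike.coe_mem _)

theorem dMat_of_mem {n : ℕ} {x : Omega K A} (hx : x ∈ deg K A n) :
    dMat K A x 0 0 = (-1) ^ n * x ∧ dMat K A x 1 0 = 0 ∧ dMat K A x 1 1 = x := by
  induction n generalizing x with
  | zero =>
    obtain ⟨a, rfl⟩ := mem_deg_zero K A hx
    simp [dMat]
  | succ n ih =>
    rw [deg_succ] at hx
    induction hx using Submodule.mul_induction_on' with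
    | mem_mul_mem m hm y hy =>
      obtain ⟨a, rfl⟩ := hy
      obtain ⟨h1, h2, h3⟩ := ih hm
      have e : dMat K A (del K A a) = !![-del K A a, 0; 0, del K A a] := by simp [dMat]
      simp [map_mul, Matrix.mul_apply, h1, h2, h3, e, pow_succ, mul_assoc]
    | add x hx y hy hx' hy' =>
      obtain ⟨h1, h2, h3⟩ := hx'
      obtain ⟨g1, g2, g3⟩ := hy'
      simp [map_add, h1, h2, h3, g1, g2, g3, mul_add]

theorem dMat_one_one (x : Omega K A) : dMat K A x 1 1 = x :=
  omega_induction K A (P := fun x => dMat K A x 1 1 = x)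
    (fun x y hx hy => by rw [map_add, Matrix.add_apply, hx, hy])
    (fun n x hx => (dMat_of_mem K A hx).2.2) x

/-- Graded Leibniz rule. -/
theorem d_mul {n : ℕ} {x : Omega K A} (hx : x ∈ deg K A n) (y : Omega K A) :
    d K A (x * y) = d K A x * y + (-1) ^ n * (x * d K A y) := by
  have h : d K A (x * y) = dMat K A x 0 0 * d K A y + d K A x * dMat K A y 1 1 := by
    simp [d, Matrix.mul_apply]
  rw [h, (dMat_of_mem K A hx).1, dMat_one_one K A y, add_comm, mul_assoc]

theorem d_of_mem_pow {n : ℕ} {x : Omega K A} (hx : x ∈ LinearMap.range (del K A) ^ n) :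
    d K A x = 0 := by
  refine Submodule.pow_induction_on_left (LinearMap.range (del K A)) (C := fun x => d K A x = 0)
    (fun r => ?_) (fun x y hx hy => by rw [map_add, hx, hy, add_zero]) ?_ hx
  · rw [← (incl K A).commutes r, d_incl, Algebra.algebraMap_eq_smul_one, map_smul, del_one,
      smul_zero]
  · rintro _ ⟨a, rfl⟩ x hx
    rw [d_mul K A (del_mem K A a), hx, d_del]
    simp

theorem d_mem_pow {n : ℕ} {x : Omega K A} (hx : x ∈ deg K A n) :
    d K A x ∈ LinearMap.range (del K A) ^ (n + 1) := by
  rw [deg] at hx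
  induction hx using Submodule.mul_induction_on' with
  | mem_mul_mem m hm y hy =>
    obtain ⟨a, rfl⟩ := hm
    change d K A (incl K A a * y) ∈ _
    rw [d_mul K A (incl_mem K A a), d_of_mem_pow K A hy, d_incl, mul_zero, mul_zero, add_zero,
      pow_succ']
    exact Submodule.mul_mem_mul ⟨a, rfl⟩ hy
  | add x hx y hy hx' hy' => rw [map_add]; exact add_mem hx' hy'

/-- `d` has degree one. -/
theorem d_mem {n : ℕ} {x : Omega K A} (hx : x ∈ deg K A n) : d K A x ∈ deg K A (n + 1) :=
  pow_le_deg K A _ (d_mem_pow K A hx)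

theorem d_d (x : Omega K A) : d K A (d K A x) = 0 :=
  omega_induction K A (P := fun x => d K A (d K A x) = 0)
    (fun x y hx hy => by rw [map_add, map_add, hx, hy, add_zero])
    (fun _ _ hx => d_of_mem_pow K A (d_mem_pow K A hx)) x

/-- The universal property: every algebra map from `A` to the degree-zero part of a dg-algebra
extends uniquely to a map of dg-algebras from `Ω•(A)`. -/
theorem existsUnique_lift {Γ : Type*} [Ring Γ] [Algebra K Γ] (𝒢 : ℕ → Submodule K Γ)
    [GradedAlgebra 𝒢] (dΓ : Γ →ₗ[K] Γ) (hdeg : ∀ n, ∀ x ∈ 𝒢 n, dΓ x ∈ 𝒢 (n + 1))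
    (hdd : ∀ x, dΓ (dΓ x) = 0)
    (hmul : ∀ n, ∀ x ∈ 𝒢 n, ∀ y, dΓ (x * y) = dΓ x * y + (-1) ^ n * (x * dΓ y))
    (ψ : A →ₐ[K] Γ) (hψ : ∀ a, ψ a ∈ 𝒢 0) :
    ∃! u : Omega K A →ₐ[K] Γ, (∀ n, ∀ x ∈ deg K A n, u x ∈ 𝒢 n) ∧
      (∀ x, u (d K A x) = dΓ (u x)) ∧ ∀ a, u (incl K A a) = ψ a := by
  have hD : ∀ a b, (dΓ ∘ₗ ψ.toLinearMap) (a * b) =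
      (dΓ ∘ₗ ψ.toLinearMap) a * ψ b + ψ a * (dΓ ∘ₗ ψ.toLinearMap) b := fun a b => by
    simp [hmul 0 _ (hψ a)]
  refine ⟨lift ψ (dΓ ∘ₗ ψ.toLinearMap) hD, ⟨?_, ?_, fun a => lift_incl _ _ _ a⟩, ?_⟩
  · intro n
    induction n with
    | zero =>
      intro x hx
      obtain ⟨a, rfl⟩ := mem_deg_zero K A hx
      rw [lift_incl]
      exact hψ a
    | succ n ih =>
      intro x hx
      rw [deg_succ] at hx
      induction hx using Submodule.mul_induction_on' with
      | mem_mul_mem m hm y hy =>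
        obtain ⟨a, rfl⟩ := hy
        rw [map_mul, lift_del]
        exact SetLike.mul_mem_graded (ih m hm) (hdeg 0 _ (hψ a))
      | add x hx y hy hx' hy' => rw [map_add]; exact add_mem hx' hy'
  · have hpow : ∀ n, ∀ x ∈ LinearMap.range (del K A) ^ n,
        dΓ (lift ψ (dΓ ∘ₗ ψ.toLinearMap) hD x) = 0 := fun n x hx => by
      refine Submodule.pow_induction_on_left (LinearMap.range (del K A))
        (C := fun x => dΓ (lift ψ (dΓ ∘ₗ ψ.toLinearMap) hD x) = 0)
        (fun r => ?_) (fun x y hx hy => by rw [map_add, map_add, hx, hy, add_zero]) ?_ hx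
      · have h1 := hmul 0 1 (SetLike.GradedOne.one_mem) 1
        simp only [mul_one, one_mul, pow_zero, left_eq_add] at h1
        rw [AlgHom.commutes, Algebra.algebraMap_eq_smul_one, map_smul, h1, smul_zero]
      · rintro _ ⟨a, rfl⟩ x hx
        rw [map_mul, lift_del, LinearMap.comp_apply, AlgHom.toLinearMap_apply, hmul 1 _ (hdeg 0 _ (hψ a)), hx, hdd]
        simp
    refine omega_induction K A (fun x y hx hy => by simp only [map_add, hx, hy]) ?_
    intro n x hx
    rw [deg] at hx
    induction hx using Submodule.mul_induction_on' with
    | mem_mul_mem m hm y hy =>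
      obtain ⟨a, rfl⟩ := hm
      change lift ψ _ hD (d K A (incl K A a * y)) = dΓ (lift ψ _ hD (incl K A a * y))
      rw [d_mul K A (incl_mem K A a), d_of_mem_pow K A hy, d_incl, mul_zero, mul_zero, add_zero,
        map_mul, map_mul, lift_del, lift_incl, hmul 0 _ (hψ a), hpow n y hy]
      simp
    | add x hx y hy hx' hy' => simp only [map_add, hx', hy']
  · rintro v ⟨-, hv, hv0⟩
    refine omega_ext (fun a => by rw [hv0, lift_incl]) (fun a => ?_)
    rw [← d_incl, hv, hv0, d_incl, lift_del]
    rfl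

end Envelope

section DeRham

variable (K : Type*) [Field K] (A : Type*) [Ring A] [Algebra K A]

/-- The linear span of the graded commutators `xy - (-1)^{ij} yx` of homogeneous forms. -/
noncomputable def gradedCommutators : Submodule K (Omega K A) :=
  Submodule.span K {z | ∃ i j : ℕ, ∃ x ∈ deg K A i, ∃ y ∈ deg K A j,
    z = x * y - (-1) ^ (i * j) * (y * x)}

/-- The Karoubi–de Rham complex `DR•(A)`, as a vector space. -/
abbrev DR := Omega K A ⧸ gradedCommutators K A

/-- The homogeneous component `DRⁿ(A)`. -/
noncomputable def DRdeg (n : ℕ) : Submodule K (DR K A) :=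
  (deg K A n).map (gradedCommutators K A).mkQ

theorem d_gradedCommutators :
    gradedCommutators K A ≤ (gradedCommutators K A).comap (d K A) := by
  rw [gradedCommutators, Submodule.span_le]
  rintro _ ⟨i, j, x, hx, y, hy, rfl⟩
  have hs : ∀ (m : ℕ) (z : Omega K A), d K A ((-1) ^ m * z) = (-1) ^ m * d K A z := by
    intro m z
    rcases neg_one_pow_eq_or (Omega K A) m with h | h <;> simp [h]
  have h1 : d K A x * y - (-1) ^ ((i + 1) * j) * (y * d K A x) ∈ gradedCommutators K A :=
    Submodule.subset_span ⟨_, _, _, d_mem K A hx, y, hy, rfl⟩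
  have h2 : x * d K A y - (-1) ^ (i * (j + 1)) * (d K A y * x) ∈ gradedCommutators K A :=
    Submodule.subset_span ⟨_, _, x, hx, _, d_mem K A hy, rfl⟩
  have h3 : (-1) ^ i * (x * d K A y - (-1) ^ (i * (j + 1)) * (d K A y * x)) ∈
      gradedCommutators K A := by
    rcases neg_one_pow_eq_or (Omega K A) i with h | h
    · simpa [h] using h2
    · simpa [h] using Submodule.neg_mem _ h2
  have e : d K A (x * y - (-1) ^ (i * j) * (y * x)) =
      (d K A x * y - (-1) ^ ((i + 1) * j) * (y * d K A x)) +
        (-1) ^ i * (x * d K A y - (-1) ^ (i * (j + 1)) * (d K A y * x)) := by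
    rw [map_sub, hs, d_mul K A hx, d_mul K A hy]
    have p1 : ((-1 : Omega K A)) ^ ((i + 1) * j) = (-1) ^ (i * j) * (-1) ^ j := by
      rw [add_mul, one_mul, pow_add]
    have p2 : ((-1 : Omega K A)) ^ (i * (j + 1)) = (-1) ^ (i * j) * (-1) ^ i := by
      rw [mul_add, mul_one, pow_add]
    rw [p1, p2]
    rcases neg_one_pow_eq_or (Omega K A) i with h | h <;>
    rcases neg_one_pow_eq_or (Omega K A) j with h' | h' <;>
    rcases neg_one_pow_eq_or (Omega K A) (i * j) with h'' | h'' <;>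
    simp only [h, h', h''] <;> noncomm_ring
  change d K A _ ∈ gradedCommutators K A
  rw [e]
  exact add_mem h1 h3

/-- The differential of the Karoubi–de Rham complex. -/
noncomputable def dDR : DR K A →ₗ[K] DR K A :=
  (gradedCommutators K A).mapQ (gradedCommutators K A) (d K A) (d_gradedCommutators K A)

/-- The closed forms in `DRⁿ(A)`. -/
noncomputable def closedForms (n : ℕ) : Submodule K (DR K A) :=
  DRdeg K A n ⊓ LinearMap.ker (dDR K A)

/-- `[A, A]`: the linear span of the commutators. -/
def commutators : Submodule K A :=
  Submodule.span K {z | ∃ u v : A, z = u * v - v * u}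

/-- The `1`-form `u dv`, as an element of `DR¹(A)`. -/
noncomputable def oneForm (u v : A) : DRdeg K A 1 :=
  ⟨(gradedCommutators K A).mkQ (incl K A u * del K A v),
    Submodule.mem_map_of_mem (incl_mul_mem K A u (del_mem K A v))⟩

/-- Auxiliary algebra map encoding the standard bimodule `A ⊗ A` and its derivation
`a ↦ 1 ⊗ a - a ⊗ 1`. -/
noncomputable def bMat : Omega K A →ₐ[K] Matrix (Fin 2) (Fin 2) (A ⊗[K] A) :=
  lift
    (AlgHom.ofLinearMap
      { toFun := fun a => !![a ⊗ₜ[K] 1, 0; 0, 1 ⊗ₜ[K] a]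
        map_add' := fun a b => by
          ext i j; fin_cases i <;> fin_cases j <;> simp [TensorProduct.add_tmul, tmul_add]
        map_smul' := fun c a => by
          ext i j; fin_cases i <;> fin_cases j <;> simp [TensorProduct.smul_tmul'] }
      (by ext i j; fin_cases i <;> fin_cases j <;> simp [Algebra.TensorProduct.one_def])
      (fun a b => by ext i j; fin_cases i <;> fin_cases j <;> simp))
    { toFun := fun a => !![0, 1 ⊗ₜ[K] a - a ⊗ₜ[K] 1; 0, 0]
      map_add' := fun a b => by
        ext i j
        fin_cases i <;> fin_cases j <;> simp [TensorProduct.add_tmul, tmul_add]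
        abel
      map_smul' := fun c a => by
        ext i j
        fin_cases i <;> fin_cases j <;> simp [TensorProduct.smul_tmul', smul_sub] }
    (fun a b => by
      ext i j
      fin_cases i <;> fin_cases j <;> simp [mul_sub, sub_mul])

/-- The map `A ⊗ A → A`, `x ⊗ y ↦ -yx`. -/
noncomputable def negMulSwap : A ⊗[K] A →ₗ[K] A :=
  -(LinearMap.mul' K A ∘ₗ (TensorProduct.comm K A A).toLinearMap)

/-- The map on all forms which is `u dv ↦ [u, v]` in degree one and zero in other degrees. -/
noncomputable def bOmega : Omega K A →ₗ[K] A :=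
  negMulSwap K A ∘ₗ Matrix.entryLinearMap K (A ⊗[K] A) 0 1 ∘ₗ (bMat K A).toLinearMap

theorem bMat_incl (a : A) : bMat K A (incl K A a) = !![a ⊗ₜ[K] 1, 0; 0, 1 ⊗ₜ[K] a] := by
  simp [bMat]

theorem bMat_del (a : A) :
    bMat K A (del K A a) = !![0, 1 ⊗ₜ[K] a - a ⊗ₜ[K] 1; 0, 0] := by
  simp [bMat]

theorem bOmega_incl_mul_del (u v : A) :
    bOmega K A (incl K A u * del K A v) = u * v - v * u := by
  simp [bOmega, bMat_incl, bMat_del, negMulSwap, mul_sub]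

theorem bMat_deg_one {x : Omega K A} (hx : x ∈ deg K A 1) :
    ∃ m, bMat K A x = !![0, m; 0, 0] := by
  rw [deg, Submodule.pow_one] at hx
  induction hx using Submodule.mul_induction_on' with
  | mem_mul_mem m hm y hy =>
    obtain ⟨a, rfl⟩ := hm
    obtain ⟨b, rfl⟩ := hy
    refine ⟨(a ⊗ₜ[K] 1) * (1 ⊗ₜ[K] b - b ⊗ₜ[K] 1), ?_⟩
    rw [map_mul, AlgHom.toLinearMap_apply, bMat_incl, bMat_del]
    simp
  | add x hx y hy hx' hy' =>
    obtain ⟨m, hm⟩ := hx'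
    obtain ⟨m', hm'⟩ := hy'
    exact ⟨m + m', by rw [map_add, hm, hm']; simp⟩

theorem bMat_deg_two {n : ℕ} {x : Omega K A} (hx : x ∈ deg K A (n + 2)) : bMat K A x = 0 := by
  have h : deg K A (n + 2) = deg K A n * (LinearMap.range (del K A) * LinearMap.range (del K A)) := by
    rw [deg_succ, deg_succ, mul_assoc]
  have h2 : ∀ z ∈ LinearMap.range (del K A) * LinearMap.range (del K A), bMat K A z = 0 := by
    intro z hz
    induction hz using Submodule.mul_induction_on' with
    | mem_mul_mem m hm y hy =>
      obtain ⟨a, rfl⟩ := hm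
      obtain ⟨b, rfl⟩ := hy
      rw [map_mul, bMat_del, bMat_del]
      ext i j
      fin_cases i <;> fin_cases j <;> simp
    | add x hx y hy hx' hy' => rw [map_add, hx', hy', add_zero]
  rw [h] at hx
  induction hx using Submodule.mul_induction_on' with
  | mem_mul_mem m hm y hy => rw [map_mul, h2 y hy, mul_zero]
  | add x hx y hy hx' hy' => rw [map_add, hx', hy', add_zero]

theorem bOmega_of_ne_one {n : ℕ} (hn : n ≠ 1) {x : Omega K A} (hx : x ∈ deg K A n) :
    bOmega K A x = 0 := by
  match n, hn with
  | 0, _ =>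
    obtain ⟨a, rfl⟩ := mem_deg_zero K A hx
    simp [bOmega, bMat_incl]
  | n + 2, _ => simp [bOmega, bMat_deg_two K A hx]

theorem negMulSwap_comm (a : A) (m : A ⊗[K] A) :
    negMulSwap K A ((a ⊗ₜ[K] 1) * m) = negMulSwap K A (m * (1 ⊗ₜ[K] a)) := by
  induction m using TensorProduct.induction_on with
  | zero => simp
  | tmul x y => simp [negMulSwap, mul_assoc]
  | add x y hx hy => rw [mul_add, add_mul, map_add, map_add, hx, hy]

theorem bOmega_comm (a : A) {x : Omega K A} (hx : x ∈ deg K A 1) :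
    bOmega K A (incl K A a * x) = bOmega K A (x * incl K A a) := by
  obtain ⟨m, hm⟩ := bMat_deg_one K A hx
  simp [bOmega, bMat_incl, hm, negMulSwap_comm]

theorem bOmega_gradedCommutators : gradedCommutators K A ≤ LinearMap.ker (bOmega K A) := by
  rw [gradedCommutators, Submodule.span_le]
  rintro _ ⟨i, j, x, hx, y, hy, rfl⟩
  change bOmega K A _ = 0
  by_cases h : i + j = 1
  · obtain ⟨rfl, rfl⟩ | ⟨rfl, rfl⟩ : (i = 0 ∧ j = 1) ∨ (i = 1 ∧ j = 0) := by omega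
    · obtain ⟨a, rfl⟩ := mem_deg_zero K A hx
      simp [bOmega_comm K A a hy]
    · obtain ⟨a, rfl⟩ := mem_deg_zero K A hy
      simp [bOmega_comm K A a hx]
  · have h1 := bOmega_of_ne_one K A h (SetLike.mul_mem_graded hx hy)
    have h2 := bOmega_of_ne_one K A (by omega) (SetLike.mul_mem_graded hy hx)
    rcases neg_one_pow_eq_or (Omega K A) (i * j) with h' | h' <;> simp [h', h1, h2]

/-- The map on `DR•(A)` induced by `bOmega`. -/
noncomputable def bDR : DR K A →ₗ[K] A :=
  (gradedCommutators K A).liftQ (bOmega K A) (bOmega_gradedCommutators K A)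

theorem bDR_mem {x : DR K A} (hx : x ∈ DRdeg K A 1) : bDR K A x ∈ commutators K A := by
  obtain ⟨y, hy, rfl⟩ := hx
  change bOmega K A y ∈ _
  rw [SetLike.mem_coe, deg, Submodule.pow_one] at hy
  induction hy using Submodule.mul_induction_on' with
  | mem_mul_mem m hm y hy =>
    obtain ⟨a, rfl⟩ := hm
    obtain ⟨b, rfl⟩ := hy
    rw [AlgHom.toLinearMap_apply, bOmega_incl_mul_del]
    exact Submodule.subset_span ⟨a, b, rfl⟩
  | add x hx y hy hx' hy' => rw [map_add]; exact add_mem hx' hy'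

/-- The map `b : DR¹(A) → [A, A]` of the Quillen complex; it is the unique
linear map with `b(u dv) = [u, v]`, by `span_oneForm` and `b_oneForm`. -/
noncomputable def b : DRdeg K A 1 →ₗ[K] commutators K A :=
  (bDR K A).restrict (fun _ hx => bDR_mem K A hx)

/-- The forms `u dv` span `DR¹(A)`. -/
theorem span_oneForm :
    Submodule.span K {x : DR K A | ∃ u v, x = oneForm K A u v} = DRdeg K A 1 := by
  refine le_antisymm (Submodule.span_le.2 ?_) ?_
  · rintro _ ⟨u, v, rfl⟩
    exact (oneForm K A u v).2
  · rintro _ ⟨x, hx, rfl⟩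
    rw [SetLike.mem_coe, deg, Submodule.pow_one] at hx
    induction hx using Submodule.mul_induction_on' with
    | mem_mul_mem m hm y hy =>
      obtain ⟨u, rfl⟩ := hm
      obtain ⟨v, rfl⟩ := hy
      exact Submodule.subset_span ⟨u, v, rfl⟩
    | add x hx y hy hx' hy' => rw [map_add]; exact add_mem hx' hy'

/-- `b(u dv) = [u, v]`. -/
theorem b_oneForm (u v : A) : (b K A (oneForm K A u v) : A) = u * v - v * u :=
  bOmega_incl_mul_del K A u v

end DeRham

end KaroubiDeRham

/-! Both `b` and `d` start from `DR¹(A)`, and `e` exists as soon as they are onto `[A, A]` and the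
closed `2`-forms with the same kernel: each target is then the same quotient of `DR¹(A)`.

Exactness comes from an Euler homotopy. A free algebra has a basis of words, and multiplying a word
by its length is a derivation. Cartan's formula `L = d i + i d` for this derivation gives an
operator that is diagonalisable on `DRⁿ(A)` with integer eigenvalues at least `n`. In characteristic
zero it is bijective in positive degrees, so closed forms there are exact
(`exists_primitive_of_free`). Hence `d` maps onto the closed `2`-forms, and a closed `1`-form is
some `da`, on which `b` gives `[1, a] = 0`; so `ker d ⊆ ker b`.

For `ker b ⊆ ker d`, a linear map `s` with `s ∘ b = d` is written down (`splitMap_bDR`): `s` sends a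
word `w` to the average, with weight `1/|w|`, of `du dv` over the factorisations `w = uv`. A cocycle
identity for `da db` (`delDel_cocycle`) makes all terms of `s([u, x])` equal to `du dx` for a letter
`x`, and the forms `u dx` span `DR¹(A)`. -/

namespace KaroubiDeRham

/-! ### Contraction, Lie derivative and Cartan homotopy for a derivation -/

section Contraction

variable {K : Type*} [Field K] {A : Type*} [Ring A] [Algebra K A]
variable (E : A →ₗ[K] A) (hE : ∀ a b, E (a * b) = E a * b + a * E b)

/-- Auxiliary algebra map `x ↦ [[±x, i x], [0, x]]`, which packages the graded Leibniz rule of the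
contraction `i` with the derivation `E`. -/
noncomputable def contractMat : Omega K A →ₐ[K] Matrix (Fin 2) (Fin 2) (Omega K A) :=
  lift
    (AlgHom.ofLinearMap
      { toFun := fun a => !![incl K A a, 0; 0, incl K A a]
        map_add' := fun a b => by ext i j; fin_cases i <;> fin_cases j <;> simp
        map_smul' := fun c a => by ext i j; fin_cases i <;> fin_cases j <;> simp }
      (by ext i j; fin_cases i <;> fin_cases j <;> simp)
      (fun a b => by ext i j; fin_cases i <;> fin_cases j <;> simp))
    { toFun := fun a => !![-del K A a, incl K A (E a); 0, del K A a]
      map_add' := fun a b => by ext i j; fin_cases i <;> fin_cases j <;> simp [add_comm]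
      map_smul' := fun c a => by ext i j; fin_cases i <;> fin_cases j <;> simp }
    (fun a b => by
      ext i j
      fin_cases i <;> fin_cases j <;> simp [del_mul, hE, add_comm])

/-- The contraction of forms with the derivation `E` of `A`. -/
noncomputable def contract : Omega K A →ₗ[K] Omega K A :=
  Matrix.entryLinearMap K (Omega K A) 0 1 ∘ₗ (contractMat E hE).toLinearMap

@[simp] theorem contract_incl (a : A) : contract E hE (incl K A a) = 0 := by
  simp [contract, contractMat]

@[simp] theorem contract_del (a : A) : contract E hE (del K A a) = incl K A (E a) := by
  simp [contract, contractMat]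

theorem contractMat_of_mem {n : ℕ} {x : Omega K A} (hx : x ∈ deg K A n) :
    contractMat E hE x 0 0 = (-1) ^ n * x ∧ contractMat E hE x 1 0 = 0 ∧
      contractMat E hE x 1 1 = x := by
  induction n generalizing x with
  | zero =>
    obtain ⟨a, rfl⟩ := mem_deg_zero K A hx
    simp [contractMat]
  | succ n ih =>
    rw [deg_succ] at hx
    induction hx using Submodule.mul_induction_on' with
    | mem_mul_mem m hm y hy =>
      obtain ⟨a, rfl⟩ := hy
      obtain ⟨h1, h2, h3⟩ := ih hm
      have e : contractMat E hE (del K A a) =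
          !![-del K A a, incl K A (E a); 0, del K A a] := by simp [contractMat]
      simp [map_mul, Matrix.mul_apply, h1, h2, h3, e, pow_succ, mul_assoc]
    | add x hx y hy hx' hy' =>
      obtain ⟨h1, h2, h3⟩ := hx'
      obtain ⟨g1, g2, g3⟩ := hy'
      simp [map_add, h1, h2, h3, g1, g2, g3, mul_add]

theorem contractMat_one_one (x : Omega K A) : contractMat E hE x 1 1 = x :=
  omega_induction K A (P := fun x => contractMat E hE x 1 1 = x)
    (fun x y hx hy => by rw [map_add, Matrix.add_apply, hx, hy])
    (fun n x hx => (contractMat_of_mem E hE hx).2.2) x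

theorem contract_mul {n : ℕ} {x : Omega K A} (hx : x ∈ deg K A n) (y : Omega K A) :
    contract E hE (x * y) = contract E hE x * y + (-1) ^ n * (x * contract E hE y) := by
  have h : contract E hE (x * y) =
      contractMat E hE x 0 0 * contract E hE y + contract E hE x * contractMat E hE y 1 1 := by
    simp [contract, Matrix.mul_apply]
  rw [h, (contractMat_of_mem E hE hx).1, contractMat_one_one, add_comm, mul_assoc]

theorem contract_of_mem_zero {x : Omega K A} (hx : x ∈ deg K A 0) : contract E hE x = 0 := by
  obtain ⟨a, rfl⟩ := mem_deg_zero K A hx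
  simp

theorem neg_one_pow_mul_mem (S : Submodule K (Omega K A)) (m : ℕ) {x : Omega K A} (hx : x ∈ S) :
    (-1) ^ m * x ∈ S := by
  rcases neg_one_pow_eq_or (Omega K A) m with h | h <;> simpa [h] using hx

theorem map_neg_one_pow_mul (f : Omega K A →ₗ[K] Omega K A) (m : ℕ) (x : Omega K A) :
    f ((-1) ^ m * x) = (-1) ^ m * f x := by
  rcases neg_one_pow_eq_or (Omega K A) m with h | h <;> simp [h]

theorem contract_mem {n : ℕ} {x : Omega K A} (hx : x ∈ deg K A (n + 1)) :
    contract E hE x ∈ deg K A n := by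
  induction n generalizing x with
  | zero =>
    rw [deg_succ] at hx
    induction hx using Submodule.mul_induction_on' with
    | mem_mul_mem m hm y hy =>
      obtain ⟨a, rfl⟩ := hy
      rw [contract_mul E hE hm, contract_of_mem_zero E hE hm, contract_del]
      simpa using mul_incl_mem K A _ hm
    | add x hx y hy hx' hy' => rw [map_add]; exact add_mem hx' hy'
  | succ n ih =>
    rw [deg_succ] at hx
    induction hx using Submodule.mul_induction_on' with
    | mem_mul_mem m hm y hy =>
      obtain ⟨a, rfl⟩ := hy
      rw [contract_mul E hE hm, contract_del]
      exact add_mem (SetLike.mul_mem_graded (ih hm) (del_mem K A a))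
        (neg_one_pow_mul_mem _ _ (mul_incl_mem K A _ hm))
    | add x hx y hy hx' hy' => rw [map_add]; exact add_mem hx' hy'

/-- An odd derivation sends a graded commutator `[x, y]` to `[i x, y] ± [x, i y]`. The exponents `i
* j + j` and `i * j + i` have the parity of `(i - 1) * j` and `i * (j - 1)` and avoid natural
subtraction; in degree zero the contracted factor vanishes, so the sign is immaterial. -/
theorem contract_gradedCommutators :
    gradedCommutators K A ≤ (gradedCommutators K A).comap (contract E hE) := by
  rw [gradedCommutators, Submodule.span_le]
  rintro _ ⟨i, j, x, hx, y, hy, rfl⟩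
  have h1 : contract E hE x * y - (-1) ^ (i * j + j) * (y * contract E hE x) ∈
      gradedCommutators K A := by
    cases i with
    | zero => simp [contract_of_mem_zero E hE hx]
    | succ i =>
      have e : (-1 : Omega K A) ^ ((i + 1) * j + j) = (-1) ^ (i * j) := by
        rw [show (i + 1) * j + j = i * j + 2 * j by ring, pow_add, pow_mul (-1) 2]
        simp
      rw [e]
      exact Submodule.subset_span ⟨_, _, _, contract_mem E hE hx, y, hy, rfl⟩
  have h2 : x * contract E hE y - (-1) ^ (i * j + i) * (contract E hE y * x) ∈
      gradedCommutators K A := by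
    cases j with
    | zero => simp [contract_of_mem_zero E hE hy]
    | succ j =>
      have e : (-1 : Omega K A) ^ (i * (j + 1) + i) = (-1) ^ (i * j) := by
        rw [show i * (j + 1) + i = i * j + 2 * i by ring, pow_add, pow_mul (-1) 2]
        simp
      rw [e]
      exact Submodule.subset_span ⟨_, _, x, hx, _, contract_mem E hE hy, rfl⟩
  have e : contract E hE (x * y - (-1) ^ (i * j) * (y * x)) =
      (contract E hE x * y - (-1) ^ (i * j + j) * (y * contract E hE x)) +
        (-1) ^ i * (x * contract E hE y - (-1) ^ (i * j + i) * (contract E hE y * x)) := by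
    rw [map_sub, map_neg_one_pow_mul, contract_mul E hE hx, contract_mul E hE hy, pow_add, pow_add]
    rcases neg_one_pow_eq_or (Omega K A) i with h | h <;>
    rcases neg_one_pow_eq_or (Omega K A) j with h' | h' <;>
    rcases neg_one_pow_eq_or (Omega K A) (i * j) with h'' | h'' <;>
    simp only [h, h', h''] <;> noncomm_ring
  change contract E hE _ ∈ gradedCommutators K A
  rw [e]
  exact add_mem h1 (neg_one_pow_mul_mem _ _ h2)

/-- The Lie derivative along `E`, by Cartan's formula. -/
noncomputable def lieDeriv : Omega K A →ₗ[K] Omega K A :=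
  d K A ∘ₗ contract E hE + contract E hE ∘ₗ d K A

theorem lieDeriv_apply (x : Omega K A) :
    lieDeriv E hE x = d K A (contract E hE x) + contract E hE (d K A x) := rfl

theorem lieDeriv_incl (a : A) : lieDeriv E hE (incl K A a) = incl K A (E a) := by
  simp [lieDeriv_apply]

theorem lieDeriv_del (a : A) : lieDeriv E hE (del K A a) = del K A (E a) := by
  simp [lieDeriv_apply]

/-- The graded commutator of two odd derivations is an even derivation: the cross terms carry
opposite signs and cancel. -/
theorem lieDeriv_mul {n : ℕ} {x : Omega K A} (hx : x ∈ deg K A n) (y : Omega K A) :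
    lieDeriv E hE (x * y) = lieDeriv E hE x * y + x * lieDeriv E hE y := by
  -- The sign `(-1)^(n-1)` is written as `-(-1)^n`; for `n = 0` the term it multiplies is zero.
  have h1 : d K A (contract E hE x * y) =
      d K A (contract E hE x) * y - (-1) ^ n * (contract E hE x * d K A y) := by
    cases n with
    | zero => simp [contract_of_mem_zero E hE hx]
    | succ n => rw [d_mul K A (contract_mem E hE hx), pow_succ]; noncomm_ring
  rw [lieDeriv_apply, lieDeriv_apply, lieDeriv_apply, d_mul K A hx, contract_mul E hE hx, map_add,
    map_add, map_neg_one_pow_mul, map_neg_one_pow_mul, h1, d_mul K A hx, contract_mul E hE hx,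
    contract_mul E hE (d_mem K A hx), pow_succ]
  rcases neg_one_pow_eq_or (Omega K A) n with h | h <;> simp only [h] <;> noncomm_ring

/-- The contraction on the Karoubi–de Rham complex. -/
noncomputable def contractDR : DR K A →ₗ[K] DR K A :=
  (gradedCommutators K A).mapQ (gradedCommutators K A) (contract E hE)
    (contract_gradedCommutators E hE)

/-- The Lie derivative on the Karoubi–de Rham complex. -/
noncomputable def lieDR : Module.End K (DR K A) :=
  dDR K A ∘ₗ contractDR E hE + contractDR E hE ∘ₗ dDR K A

theorem lieDR_apply (x : DR K A) :
    lieDR E hE x = dDR K A (contractDR E hE x) + contractDR E hE (dDR K A x) := rfl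

theorem lieDR_mkQ (x : Omega K A) :
    lieDR E hE ((gradedCommutators K A).mkQ x) = (gradedCommutators K A).mkQ (lieDeriv E hE x) :=
  rfl

theorem contractDR_mem {n : ℕ} {x : DR K A} (hx : x ∈ DRdeg K A (n + 1)) :
    contractDR E hE x ∈ DRdeg K A n := by
  obtain ⟨y, hy, rfl⟩ := hx
  exact ⟨_, contract_mem E hE hy, rfl⟩

theorem dDR_mem {n : ℕ} {x : DR K A} (hx : x ∈ DRdeg K A n) : dDR K A x ∈ DRdeg K A (n + 1) := by
  obtain ⟨y, hy, rfl⟩ := hx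
  exact ⟨_, d_mem K A hy, rfl⟩

theorem dDR_dDR (x : DR K A) : dDR K A (dDR K A x) = 0 := by
  obtain ⟨y, rfl⟩ := Submodule.mkQ_surjective _ x
  exact congrArg (gradedCommutators K A).mkQ (d_d K A y)

theorem lieDR_dDR (x : DR K A) : lieDR E hE (dDR K A x) = dDR K A (lieDR E hE x) := by
  simp [lieDR_apply, dDR_dDR]

/-- If the Lie derivative along some derivation is bijective in degrees `n + 1` and `n + 2`, then
the closed forms of degree `n + 1` are exact. -/
theorem exists_primitive {n : ℕ}
    (hsurj : ∀ ω ∈ DRdeg K A (n + 1), ∃ η ∈ DRdeg K A (n + 1), lieDR E hE η = ω)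
    (hinj : ∀ ω ∈ DRdeg K A (n + 2), lieDR E hE ω = 0 → ω = 0) {ω : DR K A}
    (hω : ω ∈ closedForms K A (n + 1)) : ∃ α ∈ DRdeg K A n, dDR K A α = ω := by
  obtain ⟨η, hη, rfl⟩ := hsurj ω hω.1
  -- With `ω = L η`, `L (d η) = d (L η) = d ω = 0`, so injectivity gives `d η = 0`. Cartan's formula
  -- then reduces to `ω = d (i η)`.
  have h : dDR K A η = 0 :=
    hinj _ (dDR_mem hη) ((lieDR_dDR E hE η).trans hω.2)
  exact ⟨contractDR E hE η, contractDR_mem E hE hη, by simp [lieDR_apply, h]⟩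

end Contraction

/-! ### Words, the Euler derivation and the Poincaré lemma -/

section Words

variable {K : Type*} [Field K] {A : Type*} [Ring A] [Algebra K A] {X : Type*}

/-- All that is used of freeness: a basis indexed by words, multiplied by concatenation. -/
theorem exists_basis_words (φ : FreeAlgebra K X ≃ₐ[K] A) :
    ∃ B : Module.Basis (List X) K A, B [] = 1 ∧ ∀ u v, B (u ++ v) = B u * B v := by
  let B : Module.Basis (List X) K A :=
    ((FreeAlgebra.basisFreeMonoid K X).map φ.toLinearEquiv).reindex FreeMonoid.toList
  have hB : ∀ u, B u = φ (FreeAlgebra.equivMonoidAlgebraFreeMonoid.symm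
      (MonoidAlgebra.of K _ (FreeMonoid.ofList u))) := fun u => by
    simp only [B, FreeAlgebra.basisFreeMonoid, Module.Basis.reindex_apply, Module.Basis.map_apply,
      Finsupp.coe_basisSingleOne]
    rfl
  refine ⟨B, ?_, fun u v => ?_⟩
  · rw [hB, FreeMonoid.ofList_nil, map_one, map_one, map_one]
  · rw [hB, hB, hB, FreeMonoid.ofList_append, map_mul, map_mul, map_mul]

theorem basis_induction (B : Module.Basis (List X) K A) {P : A → Prop} (a : A) (zero : P 0)
    (word : ∀ w, P (B w)) (add : ∀ a b, P a → P b → P (a + b)) (smul : ∀ (c : K) a, P a → P (c • a)) :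
    P a := by
  induction B.mem_span a using Submodule.span_induction with
  | mem x hx => obtain ⟨w, rfl⟩ := hx; exact word w
  | zero => exact zero
  | add x y _ _ hx hy => exact add x y hx hy
  | smul c x _ hx => exact smul c x hx

variable (B : Module.Basis (List X) K A)

/-- The Euler derivation, multiplying a word by its length. -/
noncomputable def euler : A →ₗ[K] A :=
  B.constr K fun w => (w.length : K) • B w

theorem euler_word (w : List X) : euler B (B w) = (w.length : K) • B w :=
  B.constr_basis K _ w

variable {B}

/-- Length is additive under concatenation, and both sides are bilinear, so words suffice. -/
theorem euler_mul (happ : ∀ u v, B (u ++ v) = B u * B v) (a b : A) :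
    euler B (a * b) = euler B a * b + a * euler B b := by
  have h : (LinearMap.mul K A).compr₂ (euler B) =
      (LinearMap.mul K A).comp (euler B) + (LinearMap.mul K A).compl₂ (euler B) := by
    refine B.ext fun u => B.ext fun v => ?_
    simp [← happ, euler_word, add_smul]
  simpa using LinearMap.congr_fun₂ h a b

/-- Forms of degree `n` are sums of eigenvectors of the Lie derivative along the Euler derivation,
for eigenvalues at least `n`. -/
theorem deg_le_span_eigenvectors (hnil : B [] = 1) (happ : ∀ u v, B (u ++ v) = B u * B v) (n : ℕ) :
    deg K A n ≤ Submodule.span K {x | x ∈ deg K A n ∧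
      ∃ k : ℕ, n ≤ k ∧ lieDeriv (euler B) (euler_mul happ) x = (k : K) • x} := by
  induction n with
  | zero =>
    intro x hx
    obtain ⟨a, rfl⟩ := mem_deg_zero K A hx
    induction a using basis_induction B with
    | zero => simp
    | word w =>
      refine Submodule.subset_span ⟨hx, w.length, Nat.zero_le _, ?_⟩
      rw [lieDeriv_incl, euler_word, map_smul]
    | add a b ha hb =>
      rw [map_add]
      exact add_mem (ha (incl_mem K A a)) (hb (incl_mem K A b))
    | smul c a ha =>
      rw [map_smul]
      exact Submodule.smul_mem _ _ (ha (incl_mem K A a))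
  | succ n ih =>
    have hdel : LinearMap.range (del K A) = Submodule.span K (Set.range fun w => del K A (B w)) := by
      rw [LinearMap.range_eq_map, ← B.span_eq, Submodule.map_span, ← Set.range_comp]
      rfl
    rw [deg_succ]
    refine (mul_le_mul_left ih _).trans ?_
    rw [hdel, Submodule.span_mul_span, Submodule.span_le]
    rintro _ ⟨x, ⟨hx, k, hk, hxk⟩, _, ⟨w, rfl⟩, rfl⟩
    -- Source of the bound on eigenvalues: the empty word contributes `d1 = 0`, and any other word
    -- raises the eigenvalue by its length, which is at least one.
    by_cases hw : w = []
    · simp [hw, hnil, del_one]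
    · refine Submodule.subset_span ⟨?_, k + w.length, ?_, ?_⟩
      · rw [← hdel]
        exact Submodule.mul_mem_mul hx ⟨_, rfl⟩
      · have := List.length_pos_iff.2 hw
        omega
      · simp only
        rw [lieDeriv_mul _ _ hx, hxk, lieDeriv_del, euler_word, map_smul]
        simp [add_smul]

theorem DRdeg_le_span_eigenvectors (hnil : B [] = 1) (happ : ∀ u v, B (u ++ v) = B u * B v)
    (n : ℕ) :
    DRdeg K A n ≤ Submodule.span K {x | x ∈ DRdeg K A n ∧
      ∃ k : ℕ, n ≤ k ∧ lieDR (euler B) (euler_mul happ) x = (k : K) • x} := by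
  refine (Submodule.map_mono (deg_le_span_eigenvectors hnil happ n)).trans ?_
  rw [Submodule.map_span, Submodule.span_le]
  rintro _ ⟨x, ⟨hx, k, hk, hxk⟩, rfl⟩
  refine Submodule.subset_span ⟨Submodule.mem_map_of_mem hx, k, hk, ?_⟩
  rw [lieDR_mkQ, hxk, map_smul]

/-- In positive degree every eigenvalue `k` is a positive integer, hence invertible in `K`, and an
eigenvector `x` is the image of `k⁻¹ x`. -/
theorem exists_lieDR_eq [CharZero K] (hnil : B [] = 1) (happ : ∀ u v, B (u ++ v) = B u * B v)
    {n : ℕ} (ω : DR K A) (hω : ω ∈ DRdeg K A (n + 1)) :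
    ∃ η ∈ DRdeg K A (n + 1), lieDR (euler B) (euler_mul happ) η = ω := by
  suffices h : DRdeg K A (n + 1) ≤ (DRdeg K A (n + 1)).map (lieDR (euler B) (euler_mul happ)) from
    h hω
  refine (DRdeg_le_span_eigenvectors hnil happ (n + 1)).trans (Submodule.span_le.2 ?_)
  rintro x ⟨hx, k, hk, hxk⟩
  have hk0 : (k : K) ≠ 0 := Nat.cast_ne_zero.2 (by omega)
  exact ⟨(k : K)⁻¹ • x, Submodule.smul_mem _ _ hx, by rw [map_smul, hxk, inv_smul_smul₀ hk0]⟩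

/-- Such a form lies in the eigenspace for `0` and also in the sum of the eigenspaces for nonzero
eigenvalues; eigenspaces are independent. -/
theorem eq_zero_of_lieDR_eq_zero [CharZero K] (hnil : B [] = 1)
    (happ : ∀ u v, B (u ++ v) = B u * B v) {n : ℕ} (ω : DR K A) (hω : ω ∈ DRdeg K A (n + 1))
    (h : lieDR (euler B) (euler_mul happ) ω = 0) : ω = 0 := by
  refine Submodule.disjoint_def.1
    ((lieDR (euler B) (euler_mul happ)).eigenspaces_iSupIndep 0) ω
    (Module.End.mem_eigenspace_iff.2 (by rw [h, zero_smul])) ?_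
  refine (Submodule.span_le.2 ?_ : Submodule.span K _ ≤ _)
    (DRdeg_le_span_eigenvectors hnil happ (n + 1) hω)
  rintro x ⟨-, k, hk, hxk⟩
  have hk0 : (k : K) ≠ 0 := Nat.cast_ne_zero.2 (by omega)
  exact Submodule.mem_iSup_of_mem (k : K)
    (Submodule.mem_iSup_of_mem hk0 (Module.End.mem_eigenspace_iff.2 hxk))

/-- The Poincaré lemma for free algebras. -/
theorem exists_primitive_of_free [CharZero K] (φ : FreeAlgebra K X ≃ₐ[K] A) {n : ℕ} {ω : DR K A}
    (hω : ω ∈ closedForms K A (n + 1)) : ∃ α ∈ DRdeg K A n, dDR K A α = ω := by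
  obtain ⟨B, hnil, happ⟩ := exists_basis_words φ
  exact exists_primitive (euler B) (euler_mul happ) (exists_lieDR_eq hnil happ)
    (eq_zero_of_lieDR_eq_zero hnil happ) hω

end Words

/-! ### Factoring `d` through `b` by splitting words -/

section Splitting

variable {K : Type*} [Field K] {A : Type*} [Ring A] [Algebra K A] {X : Type*}

theorem mkQ_mul_comm {i j : ℕ} {x y : Omega K A} (hx : x ∈ deg K A i) (hy : y ∈ deg K A j) :
    (gradedCommutators K A).mkQ (x * y) =
      (gradedCommutators K A).mkQ ((-1) ^ (i * j) * (y * x)) := by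
  rw [← sub_eq_zero, ← map_sub]
  exact (Submodule.Quotient.mk_eq_zero _).2 (Submodule.subset_span ⟨i, j, x, hx, y, hy, rfl⟩)

/-- The class of `da db`. -/
noncomputable def delDel (a b : A) : DR K A :=
  (gradedCommutators K A).mkQ (del K A a * del K A b)

theorem dDR_oneForm (u v : A) : dDR K A (oneForm K A u v) = delDel u v := by
  change (gradedCommutators K A).mkQ (d K A _) = _
  rw [d_mul K A (incl_mem K A u)]
  simp [delDel]

/-- After expansion by Leibniz, cyclicity modulo graded commutators gives `da db c = c da db` and,
with a sign from two odd factors, `a db dc = -dc a db`. -/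
theorem delDel_cocycle (a b c : A) :
    delDel (K := K) a (b * c) - delDel (c * a) b = delDel (a * b) c := by
  have h1 : (gradedCommutators K A).mkQ (del K A a * del K A b * incl K A c) =
      (gradedCommutators K A).mkQ (incl K A c * (del K A a * del K A b)) := by
    simpa using mkQ_mul_comm (SetLike.mul_mem_graded (del_mem K A a) (del_mem K A b))
      (incl_mem K A c)
  have h2 : (gradedCommutators K A).mkQ (incl K A a * del K A b * del K A c) =
      -(gradedCommutators K A).mkQ (del K A c * (incl K A a * del K A b)) := by
    simpa using mkQ_mul_comm (incl_mul_mem K A a (del_mem K A b)) (del_mem K A c)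
  simp only [delDel, del_mul, mul_add, add_mul, map_add, ← mul_assoc] at *
  rw [h1, h2]
  abel

variable (B : Module.Basis (List X) K A)

/-- The sum of `[du dv]` over the factorisations `w = uv` of a word. -/
noncomputable def splitSum (w : List X) : DR K A :=
  ∑ i ∈ Finset.range (w.length + 1), delDel (B (w.take i)) (B (w.drop i))

/-- A factorisation `u = pq` yields `p · qx` of `ux` and `xp · q` of `xu`. By `delDel_cocycle` the
difference of these two terms is `d(pq) dx = du dx`, whatever the cut, and there are `|u| + 1` cuts.
-/
theorem splitSum_sub {B : Module.Basis (List X) K A} (hnil : B [] = 1)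
    (happ : ∀ u v, B (u ++ v) = B u * B v) (u : List X) (x : X) :
    splitSum B (u ++ [x]) - splitSum B (x :: u) =
      ((u.length + 1 : ℕ) : K) • delDel (B u) (B [x]) := by
  have h1 : splitSum B (u ++ [x]) = ∑ i ∈ Finset.range (u.length + 1),
      delDel (B (u.take i)) (B (u.drop i) * B [x]) := by
    rw [splitSum, List.length_append, List.length_singleton, Finset.sum_range_succ]
    -- The one factorisation of `ux` not of that kind has an empty right factor and contributes
    -- nothing, as `d1 = 0`; likewise below for `xu` with an empty left factor.
    have : delDel (K := K) (B ((u ++ [x]).take (u.length + 1)))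
        (B ((u ++ [x]).drop (u.length + 1))) = 0 := by
      rw [List.drop_eq_nil_of_le (by simp), hnil, delDel, del_one, mul_zero, map_zero]
    rw [this, add_zero]
    refine Finset.sum_congr rfl fun i hi => ?_
    have hi' : i ≤ u.length := Nat.lt_succ_iff.1 (Finset.mem_range.1 hi)
    rw [List.take_append_of_le_length hi', List.drop_append_of_le_length hi', happ]
  have h2 : splitSum B (x :: u) = ∑ i ∈ Finset.range (u.length + 1),
      delDel (B [x] * B (u.take i)) (B (u.drop i)) := by
    rw [splitSum, List.length_cons, Finset.sum_range_succ']
    have : delDel (K := K) (B ((x :: u).take 0)) (B ((x :: u).drop 0)) = 0 := by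
      rw [List.take_zero, hnil, delDel, del_one, zero_mul, map_zero]
    rw [this, add_zero]
    refine Finset.sum_congr rfl fun i _ => ?_
    rw [List.take_succ_cons, List.drop_succ_cons, ← happ, List.singleton_append]
  rw [h1, h2, ← Finset.sum_sub_distrib, Finset.sum_congr rfl fun i _ => by
    rw [delDel_cocycle, ← happ, List.take_append_drop], Finset.sum_const, Finset.card_range,
    Nat.cast_smul_eq_nsmul]

/-- The linear map `A → DR(A)` sending a word to its normalised `splitSum`. -/
noncomputable def splitMap : A →ₗ[K] DR K A :=
  -- The empty word gets the value zero, through `0⁻¹ = 0`; only words of positive length enter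
  -- `splitMap_commutator`.
  B.constr K fun w => (w.length : K)⁻¹ • splitSum B w

/-- The words `ux` and `xu` share the length `|u| + 1`, so the normalisation cancels exactly the
factor in `splitSum_sub`. -/
theorem splitMap_commutator [CharZero K] {B : Module.Basis (List X) K A} (hnil : B [] = 1)
    (happ : ∀ u v, B (u ++ v) = B u * B v) (u : List X) (x : X) :
    splitMap B (B u * B [x] - B [x] * B u) = delDel (B u) (B [x]) := by
  have h0 : ((u.length + 1 : ℕ) : K) ≠ 0 := Nat.cast_ne_zero.2 (Nat.succ_ne_zero _)
  rw [← happ, ← happ, map_sub, splitMap, B.constr_basis, B.constr_basis, List.singleton_append,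
    List.length_append, List.length_singleton, List.length_cons, ← smul_sub,
    splitSum_sub hnil happ, inv_smul_smul₀ h0]

/-- Leibniz, then a rotation of `w` to the front. Iterating it reduces `u dv` to differentials of
letters. -/
theorem oneForm_mul (u v w : A) :
    (oneForm K A u (v * w) : DR K A) = oneForm K A (w * u) v + oneForm K A (u * v) w := by
  have h : (gradedCommutators K A).mkQ (incl K A u * del K A v * incl K A w) =
      (gradedCommutators K A).mkQ (incl K A w * (incl K A u * del K A v)) := by
    simpa using mkQ_mul_comm (incl_mul_mem K A u (del_mem K A v)) (incl_mem K A w)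
  simp only [oneForm, del_mul, mul_add, map_add, map_mul, ← mul_assoc] at *
  rw [h]

/-- The forms `w dx` with `w` a word and `x` a letter span `DR¹(A)`. -/
theorem DRdeg_one_le_span {B : Module.Basis (List X) K A} (hnil : B [] = 1)
    (happ : ∀ u v, B (u ++ v) = B u * B v) :
    DRdeg K A 1 ≤ Submodule.span K {α | ∃ w x, α = (oneForm K A (B w) (B [x]) : DR K A)} := by
  set S := Submodule.span K {α | ∃ w x, α = (oneForm K A (B w) (B [x]) : DR K A)} with hS
  have hlet : ∀ (u : A) (x : X), (oneForm K A u (B [x]) : DR K A) ∈ S := fun u x => by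
    induction u using basis_induction B with
    | zero => simp [oneForm]
    | word w => exact Submodule.subset_span ⟨w, x, rfl⟩
    | add a b ha hb =>
      simp only [oneForm, map_add, add_mul] at *
      exact add_mem ha hb
    | smul c a ha =>
      simp only [oneForm, map_smul, smul_mul_assoc] at *
      exact Submodule.smul_mem _ _ ha
  -- The coefficient `u` stays general because splitting off a letter changes it.
  have hword : ∀ (w : List X) (u : A), (oneForm K A u (B w) : DR K A) ∈ S := fun w => by
    induction w with
    | nil => intro u; simp [oneForm, hnil, del_one]
    | cons x w ih =>
      intro u
      rw [← List.singleton_append, happ, oneForm_mul]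
      exact add_mem (hlet _ x) (ih _)
  rw [← span_oneForm, Submodule.span_le]
  rintro _ ⟨u, v, rfl⟩
  induction v using basis_induction B with
  | zero => simp [oneForm]
  | word w => exact hword w u
  | add a b ha hb =>
    simp only [oneForm, map_add, mul_add, SetLike.mem_coe] at *
    exact add_mem ha hb
  | smul c a ha =>
    simp only [oneForm, map_smul, mul_smul_comm, SetLike.mem_coe] at *
    exact Submodule.smul_mem _ _ ha

/-- By linearity it is enough to treat `w dx` with `x` a letter, where `b` gives `[w, x]` and
`splitMap_commutator` applies. -/
theorem splitMap_bDR [CharZero K] {B : Module.Basis (List X) K A} (hnil : B [] = 1)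
    (happ : ∀ u v, B (u ++ v) = B u * B v) {α : DR K A} (hα : α ∈ DRdeg K A 1) :
    splitMap B (bDR K A α) = dDR K A α := by
  refine LinearMap.eqOn_span (f := splitMap B ∘ₗ bDR K A) (g := dDR K A) ?_
    (DRdeg_one_le_span hnil happ hα)
  rintro _ ⟨w, x, rfl⟩
  rw [dDR_oneForm, ← splitMap_commutator hnil happ]
  exact congrArg (splitMap B) (bOmega_incl_mul_del K A _ _)

end Splitting

/-! ### Comparison of the kernels of `d` and `b` -/

section Main

variable {K : Type*} [Field K] {A : Type*} [Ring A] [Algebra K A] {X : Type*}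

variable (K A) in
/-- The differential from `1`-forms to closed `2`-forms. -/
noncomputable def dOne : DRdeg K A 1 →ₗ[K] closedForms K A 2 :=
  (dDR K A).restrict fun _ hx => ⟨dDR_mem hx, dDR_dDR _⟩

theorem b_surjective : Function.Surjective (b K A) := by
  rw [← LinearMap.range_eq_top, ← Submodule.map_injective_of_injective
    (commutators K A).injective_subtype |>.eq_iff, Submodule.map_subtype_top]
  refine le_antisymm (Submodule.map_subtype_le _ _) (Submodule.span_le.2 ?_)
  rintro _ ⟨u, v, rfl⟩
  exact ⟨_, ⟨oneForm K A u v, rfl⟩, b_oneForm K A u v⟩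

/-- Since `da = 1 da`, the value is `[1, a]`. -/
theorem bDR_dDR {β : DR K A} (hβ : β ∈ DRdeg K A 0) : bDR K A (dDR K A β) = 0 := by
  obtain ⟨x, hx, rfl⟩ := hβ
  obtain ⟨a, rfl⟩ := mem_deg_zero K A hx
  change bOmega K A (d K A (incl K A a)) = 0
  simpa using bOmega_incl_mul_del K A 1 a

/-- On `1`-forms of a free algebra, `b` and `d` have the same kernel. -/
theorem ker_dOne_eq_ker_b [CharZero K] (φ : FreeAlgebra K X ≃ₐ[K] A) :
    LinearMap.ker (dOne K A) = LinearMap.ker (b K A) := by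
  ext α
  rw [LinearMap.mem_ker, LinearMap.mem_ker, Subtype.ext_iff, Subtype.ext_iff]
  change dDR K A α = 0 ↔ bDR K A α = 0
  constructor
  -- A closed `1`-form is exact by the Poincaré lemma, and `b` kills exact forms.
  · intro h
    obtain ⟨β, hβ, hα⟩ := exists_primitive_of_free φ ⟨α.2, h⟩
    rw [← hα, bDR_dDR hβ]
  -- Conversely `d` factors through `b` by `splitMap`.
  · intro h
    obtain ⟨B, hnil, happ⟩ := exists_basis_words φ
    rw [← splitMap_bDR hnil happ α.2, h, map_zero]

end Main

end KaroubiDeRham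

theorem mainTheorem4 {K : Type*} [Field K] [CharZero K] {A : Type*} [Ring A] [Algebra K A]
    {X : Type*} (φ : FreeAlgebra K X ≃ₐ[K] A) :
    (∀ ω : KaroubiDeRham.closedForms K A 2, ∃ α : KaroubiDeRham.DRdeg K A 1,
      KaroubiDeRham.dDR K A α = ω) ∧
    ∃! e : KaroubiDeRham.closedForms K A 2 ≃ₗ[K] KaroubiDeRham.commutators K A,
      ∀ (ω : KaroubiDeRham.closedForms K A 2) (α : KaroubiDeRham.DRdeg K A 1),
        KaroubiDeRham.dDR K A α = ω → e ω = KaroubiDeRham.b K A α := by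
  have hprim : ∀ ω : KaroubiDeRham.closedForms K A 2, ∃ α : KaroubiDeRham.DRdeg K A 1,
      KaroubiDeRham.dDR K A α = ω := fun ω => by
    obtain ⟨α, hα, h⟩ := KaroubiDeRham.exists_primitive_of_free φ ω.2
    exact ⟨⟨α, hα⟩, h⟩
  have hsurj : Function.Surjective (KaroubiDeRham.dOne K A) := fun ω => by
    obtain ⟨α, h⟩ := hprim ω
    exact ⟨α, Subtype.ext h⟩
  -- The composite `DR²(A)_cl ≅ DR¹(A)/ker d = DR¹(A)/ker b ≅ [A, A]`.
  let e₀ := ((KaroubiDeRham.dOne K A).quotKerEquivOfSurjective hsurj).symm ≪≫ₗ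
      Submodule.quotEquivOfEq _ _ (KaroubiDeRham.ker_dOne_eq_ker_b φ) ≪≫ₗ
      (KaroubiDeRham.b K A).quotKerEquivOfSurjective KaroubiDeRham.b_surjective
  have he₀ : ∀ (ω : KaroubiDeRham.closedForms K A 2) (α : KaroubiDeRham.DRdeg K A 1),
      KaroubiDeRham.dDR K A α = ω → e₀ ω = KaroubiDeRham.b K A α := fun ω α h => by
    obtain rfl : KaroubiDeRham.dOne K A α = ω := Subtype.ext h
    have hq : ((KaroubiDeRham.dOne K A).quotKerEquivOfSurjective hsurj).symm
        (KaroubiDeRham.dOne K A α) = Submodule.Quotient.mk α :=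
      (LinearEquiv.symm_apply_eq _).2 rfl
    simp only [e₀, LinearEquiv.trans_apply, hq]
    rfl
  refine ⟨hprim, e₀, he₀, fun e he => ?_⟩
  ext1 ω
  -- Uniqueness: every `ω` has a primitive, and its image under `b` prescribes the value at `ω`.
  obtain ⟨α, h⟩ := hprim ω
  rw [he ω α h, he₀ ω α h]
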